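/- Let $\Bbbk$ be a commutative ring (associative, unital). For a small category $\mathcal C$, a $\Bbbk\mathcal C$-module is a functor from $\mathcal C$ to the category of $\Bbbk$-modules. For a functor $F$ between small categories, $\operatorname{res}_F$ denotes precomposition with $F$ and $\operatorname{ind}_F$ denotes its left adjoint (left Kan extension along $F$); both are applied degreewise to chain complexes. A category is EI if all its endomorphisms are isomorphisms. For a small EI category $\mathcal C$, let $\operatorname{cl}(c)$ be the isomorphism class of an object $c$. The set $[\mathcal C]$ of isomorphism classes is partially ordered by $\operatorname{cl}(c)\le\operatorname{cl}(d)$ if and only if there is a morphism $c\to d$. For a subset $S$ of $[\mathcal C]$, let $\uparrow\! S$ be the smallest upper set containing $S$; a subset is Artinian if each of its non-empty subsets has a minimal element. For a full subcategory $\mathcal C'$ of $\mathcal C$, regard $[\mathcal C']$ as a subset of $[\mathcal C]$. For a $\Bbbk\mathcal C$-module $M$ put $\operatorname{supp}(M)=\{\operatorname{cl}(c): M(c)\ne 0\}$ and $\operatorname{minsupp}(M)=\{\operatorname{cl}(c): M(c)\ne\sum_{u} \operatorname{im} M(u)\}$, where $u$ runs over all non-isomorphisms with target $c$. For a chain complex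 $C_\bullet$ put $\operatorname{minsupp}(C_\bullet)=\bigcup_n\operatorname{minsupp}(C_n)$. An epimorphism $p:L\to M$ is superfluous if every morphism $g$ with target $L$ is epic if and only if $pg$ is epic; a projective cover is a superfluous epimorphism with projective source. A projective resolution $\varepsilon: P_\bullet\to M$ is minimal if $\varepsilon:P_0\to M$, $P_1\to\ker\varepsilon$ and $P_{n}\to\ker(P_{n-1}\to P_{n-2})$ for all $n\ge2$ are projective covers. If $M$ has a minimal projective resolution $P_\bullet$ (which is then unique up to isomorphism), the Betti category $\mathcal B(M)$ is the full subcategory of $\mathcal C$ on the objects $c$ with $\operatorname{cl}(c)\in\operatorname{minsupp}(P_\bullet)$. **Theorem.** Let $\mathcal C$ and $\mathcal D$ be small EI categories. Let $\varepsilon:P_\bullet\to M$ be a minimal projective resolution of a $\Bbbk\mathcal C$-module $M$, and $\delta:Q_\bullet\to N$ a minimal projective resolution of a $\Bbbk\mathcal D$-module $N$. Assume that $\uparrow\!\operatorname{supp}(M)$ and $\uparrow\!\operatorname{supp}(N)$ are Artinian. Let $\varrho:\mathcal C'\to\mathcal C$ and $\varsigma:\mathcal D'\to\mathcal D$ be the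 inclusions of full subcategories such that $\operatorname{minsupp}(P_\bullet)\subseteq[\mathcal C']$ and $\operatorname{minsupp}(Q_\bullet)\subseteq[\mathcal D']$. Let $\alpha:\mathcal C'\to\mathcal D'$ be an equivalence of categories and let $$f:\operatorname{res}_{\varrho}(M)\xrightarrow{\ \cong\ }\operatorname{res}_{\varsigma\circ\alpha}(N)$$ be an isomorphism of $\Bbbk\mathcal C'$-modules. Then: 1. $\alpha$ induces an equivalence of Betti categories $\mathcal B(M)\to\mathcal B(N)$. That is, an object $c$ of $\mathcal C'$ lies in $\mathcal B(M)$ if and only if $\alpha(c)$ lies in $\mathcal B(N)$, and there is an equivalence $e:\mathcal B(M)\to\mathcal B(N)$ whose restriction to the full subcategory on the objects lying in both $\mathcal C'$ and $\mathcal B(M)$ is naturally isomorphic, as a functor to $\mathcal D$, to the restriction of $\varsigma\circ\alpha$. 2. $f$ induces an isomorphism of chain complexes of $\Bbbk\mathcal C$-modules $$\Phi:P_\bullet\cong\operatorname{ind}_{\varrho}\operatorname{res}_{\varsigma\circ\alpha}(Q_\bullet).$$ That is, there is such an isomorphism for which the composite $$P_0\xrightarrow{\Phi_0}\operatorname{ind}_\varrho\operatorname{res}_{\varsigma\circ\alpha}(Q_0)\xrightarrow{\operatorname{ind}_\varrho\operatorname{res}_{\varsigma\circ\alpha}(\delta)}\operatorname{ind}_\varrho\operatorname{res}_{\varsigma\circ\alpha}(N)\xrightarrow{\operatorname{ind}_\varrho(f^{-1})}\operatorname{ind}_\varrho\operatorname{res}_\varrho(M)\to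 M,$$ with the counit of the adjunction as last map, equals $\varepsilon$. -/

import Mathlib

open CategoryTheory CategoryTheory.Limits

universe v u

noncomputable section

namespace BettiCat

/-! ### EI categories and the poset of isomorphism classes -/

/-- A category is EI if all its endomorphisms are isomorphisms. -/
class IsEICategory (C : Type u) [Category.{v} C] : Prop where
  isIso_of_endo : ∀ {c : C} (f : c ⟶ c), IsIso f

/-- The set of isomorphism classes of objects of `C`. -/
def IsoClasses (C : Type u) [Category.{v} C] : Type u :=
  Quotient (isIsomorphicSetoid C)

/-- The isomorphism class of an object. -/
def cl {C : Type u} [Category.{v} C] (c : C) : IsoClasses C :=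
  Quotient.mk (isIsomorphicSetoid C) c

theorem cl_eq_iff {C : Type u} [Category.{v} C] {c d : C} :
    cl c = cl d ↔ Nonempty (c ≅ d) :=
  Quotient.eq (r := isIsomorphicSetoid C)

/-- `cl c ≤ cl d` if and only if there is a morphism `c ⟶ d`. -/
instance {C : Type u} [Category.{v} C] : Preorder (IsoClasses C) where
  le x y := Quotient.liftOn₂ (s₁ := isIsomorphicSetoid C) (s₂ := isIsomorphicSetoid C) x y
    (fun c d => Nonempty (c ⟶ d)) (by
      rintro a b a' b' ⟨i⟩ ⟨j⟩
      exact propext ⟨fun ⟨f⟩ => ⟨i.inv ≫ f ≫ j.hom⟩, fun ⟨f⟩ => ⟨i.hom ≫ f ≫ j.inv⟩⟩)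
  le_refl x := Quotient.inductionOn (s := isIsomorphicSetoid C) x fun c => ⟨𝟙 c⟩
  le_trans x y z := Quotient.inductionOn₃ (s₁ := isIsomorphicSetoid C)
    (s₂ := isIsomorphicSetoid C) (s₃ := isIsomorphicSetoid C) x y z
    fun _ _ _ ⟨f⟩ ⟨g⟩ => ⟨f ≫ g⟩

theorem cl_le_cl_iff {C : Type u} [Category.{v} C] {c d : C} :
    cl c ≤ cl d ↔ Nonempty (c ⟶ d) :=
  Iff.rfl

instance {C : Type u} [Category.{v} C] [IsEICategory C] : PartialOrder (IsoClasses C) where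
  le_antisymm x y := Quotient.inductionOn₂ (s₁ := isIsomorphicSetoid C)
    (s₂ := isIsomorphicSetoid C) x y fun c d ⟨f⟩ ⟨g⟩ => by
      have h₁ : IsIso (f ≫ g) := IsEICategory.isIso_of_endo _
      have h₂ : IsIso (g ≫ f) := IsEICategory.isIso_of_endo _
      have h₃ : IsSplitMono f := IsSplitMono.mk' ⟨g ≫ inv (f ≫ g), by
        rw [← Category.assoc, IsIso.hom_inv_id]⟩
      have h₄ : Epi f := epi_of_epi g f
      have h₅ : IsIso f := isIso_of_epi_of_isSplitMono f
      exact cl_eq_iff.2 ⟨asIso f⟩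

/-- The set of isomorphism classes of `C` that meet the full subcategory of `C` on the
objects that satisfy `S`. -/
def classesOf {C : Type u} [Category.{v} C] (S : ObjectProperty C) : Set (IsoClasses C) :=
  {x | ∃ c : C, S c ∧ cl c = x}

/-! ### Modules over a category, restriction, induction, supports -/

/-- The category of `k`-linear modules over the small category `C`: functors from `C` to
`k`-modules. -/
abbrev CatMod (k : Type u) [CommRing k] (C : Type u) [SmallCategory C] :=
  C ⥤ ModuleCat.{u} k

section Modules

variable {k : Type u} [CommRing k] {C D : Type u} [SmallCategory C] [SmallCategory D]

/-- Restriction along a functor: precomposition. -/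
abbrev res (k : Type u) [CommRing k] (F : C ⥤ D) : CatMod k D ⥤ CatMod k C :=
  (Functor.whiskeringLeft C D (ModuleCat.{u} k)).obj F

/-- Induction along a functor: the left Kan extension, left adjoint to restriction. -/
abbrev ind (k : Type u) [CommRing k] (F : C ⥤ D) : CatMod k C ⥤ CatMod k D :=
  F.lan

/-- The adjunction between induction and restriction. -/
abbrev indResAdj (k : Type u) [CommRing k] (F : C ⥤ D) : ind k F ⊣ res k F :=
  F.lanAdjunction (ModuleCat.{u} k)

instance (F : C ⥤ D) : (ind k F).Additive :=
  (indResAdj k F).left_adjoint_additive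

/-- Degreewise restriction of chain complexes. -/
abbrev resComplex (k : Type u) [CommRing k] (F : C ⥤ D) :
    ChainComplex (CatMod k D) ℕ ⥤ ChainComplex (CatMod k C) ℕ :=
  (res k F).mapHomologicalComplex (ComplexShape.down ℕ)

/-- Degreewise induction of chain complexes. -/
abbrev indComplex (k : Type u) [CommRing k] (F : C ⥤ D) :
    ChainComplex (CatMod k C) ℕ ⥤ ChainComplex (CatMod k D) ℕ :=
  (ind k F).mapHomologicalComplex (ComplexShape.down ℕ)

/-- The support of a module: the classes of the objects at which it is nonzero. -/
def supp (M : CatMod k C) : Set (IsoClasses C) :=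
  {x | ∃ c : C, cl c = x ∧ Nontrivial (M.obj c)}

/-- The value at `c` of the radical of `M`: the submodule of `M(c)` generated by the images of
the maps `M(u)`, where `u : b ⟶ c` runs over the non-isomorphisms with target `c`. -/
def jrad (M : CatMod k C) (c : C) : Submodule k (M.obj c) :=
  ⨆ (b : C) (u : b ⟶ c) (_ : ¬ IsIso u), LinearMap.range (M.map u).hom

/-- The value at `c` of the splitting functor at `M`. -/
abbrev spl (M : CatMod k C) (c : C) : Type u :=
  M.obj c ⧸ jrad M c

/-- The minimal support of a module. -/
def minsupp (M : CatMod k C) : Set (IsoClasses C) :=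
  {x | ∃ c : C, cl c = x ∧ Nontrivial (spl M c)}

/-- The minimal support of a chain complex of modules. -/
def minsuppComplex (K : ChainComplex (CatMod k C) ℕ) : Set (IsoClasses C) :=
  ⋃ n : ℕ, minsupp (K.X n)

end Modules

/-! ### Minimal projective resolutions -/

section Resolutions

variable {A : Type u} [Category.{v} A]

/-- An epimorphism `f : L ⟶ M` is superfluous if a morphism `g` to `L` is epic exactly when
its composite with `f` is epic. -/
structure IsSuperfluousEpi {L M : A} (f : L ⟶ M) : Prop where
  epi : Epi f
  epi_iff : ∀ {K : A} (g : K ⟶ L), Epi g ↔ Epi (g ≫ f)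

/-- A projective cover: a superfluous epimorphism from a projective object. -/
structure IsProjectiveCover {P M : A} (f : P ⟶ M) : Prop where
  projective : Projective P
  superfluous : IsSuperfluousEpi f

variable [Abelian A] {M : A}

/-- The augmentation `P₀ ⟶ M` of a projective resolution. -/
def augmentation (P : ProjectiveResolution M) : P.complex.X 0 ⟶ M :=
  P.π.f 0 ≫ (HomologicalComplex.singleObjXSelf (ComplexShape.down ℕ) 0 M).hom

theorem d_comp_augmentation (P : ProjectiveResolution M) :
    P.complex.d 1 0 ≫ augmentation P = 0 := by
  unfold augmentation
  rw [← Category.assoc, P.complex_d_comp_π_f_zero, zero_comp]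

/-- A projective resolution is minimal if `P₀ ⟶ M`, `P₁ ⟶ ker (P₀ ⟶ M)` and
`Pₙ₊₂ ⟶ ker (Pₙ₊₁ ⟶ Pₙ)` for all `n` are projective covers. -/
structure IsMinimalResolution (P : ProjectiveResolution M) : Prop where
  zero : IsProjectiveCover (augmentation P)
  one : IsProjectiveCover
    (kernel.lift (augmentation P) (P.complex.d 1 0) (d_comp_augmentation P))
  succ : ∀ n : ℕ, IsProjectiveCover
    (kernel.lift (P.complex.d (n + 1) n) (P.complex.d (n + 2) (n + 1))
      (P.complex.d_comp_d (n + 2) (n + 1) n))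

end Resolutions

/-! ### Betti categories -/

/-- The objects of the Betti category of `M`, where `P` is a minimal projective resolution of
`M` (all of these are isomorphic): the objects whose class lies in the minimal support of `P`. -/
def bettiObjects {k : Type u} [CommRing k] {C : Type u} [SmallCategory C] {M : CatMod k C}
    (P : ProjectiveResolution M) : ObjectProperty C :=
  fun c => cl c ∈ minsuppComplex P.complex

/-- The Betti category of `M`, where `P` is a minimal projective resolution of `M`: a full
subcategory of `C`. -/
abbrev BettiCategory {k : Type u} [CommRing k] {C : Type u} [SmallCategory C] {M : CatMod k C}
    (P : ProjectiveResolution M) : Type u :=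
  (bettiObjects P).FullSubcategory

end BettiCat

end

namespace BettiCat

universe v' u'

/-! ### Projective covers -/

section Covers

variable {A : Type u} [Category.{v} A]

/-! Put `F = ϱ` and `G = ς ∘ α`, both fully faithful. Then `ind` along each is fully faithful, so
restriction is an exact coreflection.

Sources of projective covers vanish off the upper closure of the support, so all `Pₙ` live on an
Artinian upper set. Nakayama's lemma (`isGeneratedAlong_of_minsupp`) then generates `Pₙ` by its
values along `F`. Hence the counit at `Pₙ` is epic, and even an isomorphism, as `Pₙ` is projective
(`isIso_counit_of_projective`). On such modules restriction preserves projective covers, so `res P`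
and `res Q` are minimal over `res M ≅ res N`. By uniqueness (`IsMinimalComplex.exists_iso`), `f`
lifts to `res P ≅ res Q`, and inducing gives `P ≅ ind res P ≅ ind res Q`.

For generated modules, restriction also preserves radicals (`IsGeneratedAlong.jrad_res`), so minimal
supports, and with them the Betti categories, correspond. -/

theorem IsProjectiveCover.comp_isIso {P M N : A} {p : P ⟶ M} (hp : IsProjectiveCover p)
    (i : M ⟶ N) [IsIso i] : IsProjectiveCover (p ≫ i) := by
  have := hp.superfluous.epi
  refine ⟨hp.projective, inferInstance, fun g => ?_⟩
  rw [hp.superfluous.epi_iff g, ← Category.assoc]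
  refine ⟨fun _ => inferInstance, fun h => ?_⟩
  have : Epi (((g ≫ p) ≫ i) ≫ inv i) := inferInstance
  simpa using this

/-- A morphism of projective covers over an isomorphism is an isomorphism. -/
theorem IsProjectiveCover.isIso_of_comm {P Q M N : A} {p : P ⟶ M} {q : Q ⟶ N}
    (hp : IsProjectiveCover p) (hq : IsProjectiveCover q) {i : M ⟶ N} [IsIso i] {φ : P ⟶ Q}
    (h : φ ≫ q = p ≫ i) : IsIso φ := by
  have := hp.superfluous.epi
  have := hq.superfluous.epi
  have := hq.projective
  have hφ : Epi φ := (hq.superfluous.epi_iff φ).2 (by rw [h]; infer_instance)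
  have hs : Projective.factorThru (𝟙 Q) φ ≫ φ = 𝟙 Q := Projective.factorThru_comp _ _
  have hsp : Projective.factorThru (𝟙 Q) φ ≫ p = q ≫ inv i := by
    rw [← cancel_mono i, Category.assoc, ← h, ← Category.assoc, hs]
    simp
  -- Superfluity of `p` makes the section of `φ` epic; being split monic too, it is invertible.
  have : Epi (Projective.factorThru (𝟙 Q) φ) :=
    (hp.superfluous.epi_iff _).2 (by rw [hsp]; infer_instance)
  have : IsSplitMono (Projective.factorThru (𝟙 Q) φ) := IsSplitMono.mk' ⟨φ, hs⟩
  have : IsIso (Projective.factorThru (𝟙 Q) φ) := isIso_of_epi_of_isSplitMono _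
  rw [← IsIso.inv_eq_of_hom_inv_id hs]
  infer_instance

end Covers

/-! ### Minimal augmented complexes -/

section MinimalComplexes

variable {A : Type u} [Category.{v} A] [Abelian A]

/-- A chain complex with an augmentation such that the augmentation and the corestrictions of the
differentials to the kernels of the preceding ones are projective covers. -/
structure IsMinimalComplex (X : ChainComplex A ℕ) {M : A} (ε : X.X 0 ⟶ M) : Prop where
  w : X.d 1 0 ≫ ε = 0
  zero : IsProjectiveCover ε
  one : IsProjectiveCover (kernel.lift ε (X.d 1 0) w)
  succ : ∀ n : ℕ, IsProjectiveCover
    (kernel.lift (X.d (n + 1) n) (X.d (n + 2) (n + 1)) (X.d_comp_d (n + 2) (n + 1) n))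

theorem IsMinimalResolution.isMinimalComplex {M : A} {P : ProjectiveResolution M}
    (hP : IsMinimalResolution P) : IsMinimalComplex P.complex (augmentation P) :=
  ⟨d_comp_augmentation P, hP.zero, hP.one, hP.succ⟩

/-- Lifting a morphism on kernels along a projective cover of the kernel. -/
theorem exists_lift_of_isProjectiveCover_kernel {P₂ P₁ P₀ Q₂ Q₁ Q₀ : A} {d₂ : P₂ ⟶ P₁}
    {d₁ : P₁ ⟶ P₀} {e₂ : Q₂ ⟶ Q₁} {e₁ : Q₁ ⟶ Q₀} (hd : d₂ ≫ d₁ = 0) (he : e₂ ≫ e₁ = 0)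
    (hP : Projective P₂) (hq : IsProjectiveCover (kernel.lift e₁ e₂ he)) (f₁ : P₁ ⟶ Q₁)
    (f₀ : P₀ ⟶ Q₀) (hf : f₁ ≫ e₁ = d₁ ≫ f₀) : ∃ f₂ : P₂ ⟶ Q₂, f₂ ≫ e₂ = d₂ ≫ f₁ := by
  have := hq.superfluous.epi
  have h : (d₂ ≫ f₁) ≫ e₁ = 0 := by rw [Category.assoc, hf, ← Category.assoc, hd, zero_comp]
  refine ⟨Projective.factorThru (kernel.lift e₁ _ h) (kernel.lift e₁ e₂ he), ?_⟩
  have := Projective.factorThru_comp (kernel.lift e₁ _ h) (kernel.lift e₁ e₂ he) =≫ kernel.ι e₁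
  rwa [Category.assoc, kernel.lift_ι, kernel.lift_ι] at this

theorem isIso_of_isProjectiveCover_kernel {P₂ P₁ P₀ Q₂ Q₁ Q₀ : A} {d₂ : P₂ ⟶ P₁}
    {d₁ : P₁ ⟶ P₀} {e₂ : Q₂ ⟶ Q₁} {e₁ : Q₁ ⟶ Q₀} {hd : d₂ ≫ d₁ = 0} {he : e₂ ≫ e₁ = 0}
    (hp : IsProjectiveCover (kernel.lift d₁ d₂ hd)) (hq : IsProjectiveCover (kernel.lift e₁ e₂ he))
    {f₂ : P₂ ⟶ Q₂} (f₁ : P₁ ⟶ Q₁) [IsIso f₁]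
    (f₀ : P₀ ⟶ Q₀) [IsIso f₀] (h₁ : f₁ ≫ e₁ = d₁ ≫ f₀) (h₂ : f₂ ≫ e₂ = d₂ ≫ f₁) : IsIso f₂ := by
  refine hp.isIso_of_comm hq (i := (kernel.mapIso d₁ e₁ (asIso f₁) (asIso f₀) h₁.symm).hom) ?_
  rw [← cancel_mono (kernel.ι e₁)]
  simp [h₂, kernel.mapIso, kernel.map]

/-- Minimal complexes over isomorphic objects are isomorphic. -/
theorem IsMinimalComplex.exists_iso {X Y : ChainComplex A ℕ} {M N : A} {ε : X.X 0 ⟶ M}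
    {δ : Y.X 0 ⟶ N} (hX : IsMinimalComplex X ε) (hY : IsMinimalComplex Y δ) (f : M ≅ N) :
    ∃ φ : X ≅ Y, φ.hom.f 0 ≫ δ = ε ≫ f.hom := by
  have hproj : ∀ n, Projective (X.X n)
    | 0 => hX.zero.projective
    | 1 => hX.one.projective
    | n + 2 => (hX.succ n).projective
  have := hY.zero.superfluous.epi
  have h₀ : Projective.factorThru (ε ≫ f.hom) δ ≫ δ = ε ≫ f.hom := Projective.factorThru_comp _ _
  obtain ⟨f₁, h₁⟩ := exists_lift_of_isProjectiveCover_kernel hX.w hY.w (hproj 1) hY.one _ _ h₀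
  let φ : X ⟶ Y := ChainComplex.mkHom X Y _ f₁ h₁ fun n p =>
    have h := exists_lift_of_isProjectiveCover_kernel (X.d_comp_d (n + 2) (n + 1) n)
      (Y.d_comp_d (n + 2) (n + 1) n) (hproj (n + 2)) (hY.succ n) p.2.1 p.1 p.2.2
    ⟨h.choose, h.choose_spec⟩
  have hφ : φ.f 0 ≫ δ = ε ≫ f.hom := h₀
  have i₀ : IsIso (φ.f 0) := hX.zero.isIso_of_comm hY.zero hφ
  have i₁ : IsIso (φ.f 1) := isIso_of_isProjectiveCover_kernel hX.one hY.one _ _ hφ (φ.comm 1 0)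
  -- Consecutive pairs: degree `n + 2` covers the kernel of a differential between degrees `n + 1`
  -- and `n`, so isomorphisms in both are needed.
  have key : ∀ n, IsIso (φ.f n) ∧ IsIso (φ.f (n + 1)) := by
    intro n
    induction n with
    | zero => exact ⟨i₀, i₁⟩
    | succ n ih =>
      obtain ⟨_, _⟩ := ih
      exact ⟨inferInstance, isIso_of_isProjectiveCover_kernel (hX.succ n) (hY.succ n) _ _
        (φ.comm (n + 1) n) (φ.comm (n + 2) (n + 1))⟩
  have := fun n => (key n).1
  exact ⟨HomologicalComplex.Hom.isoOfComponents (fun n => asIso (φ.f n))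
    (fun i j _ => φ.comm i j), hφ⟩

end MinimalComplexes

/-! ### Coreflections preserve minimal complexes -/

section Coreflection

variable {A : Type u} [Category.{v} A] {B : Type u'} [Category.{v'} B] {L : B ⥤ A} {R : A ⥤ B}
  (adj : L ⊣ R)

include adj in
-- Projectivity gives a section `s` of the counit, and `R` inverts both. Naturality of the counit at
-- `s`, whose left side is an isomorphism followed by a split epimorphism, shows that `s` is epic,
-- hence invertible.
theorem isIso_counit_of_projective [L.Full] [L.Faithful]
    {P : A} [Projective P] [Epi (adj.counit.app P)] : IsIso (adj.counit.app P) := by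
  have hs : Projective.factorThru (𝟙 P) (adj.counit.app P) ≫ adj.counit.app P = 𝟙 P :=
    Projective.factorThru_comp _ _
  set s := Projective.factorThru (𝟙 P) (adj.counit.app P)
  have hR : IsIso (R.map (adj.counit.app P)) := by
    rw [← IsIso.inv_eq_of_hom_inv_id (adj.right_triangle_components P)]
    infer_instance
  have hsR : IsIso (R.map s) := by
    have : R.map s ≫ R.map (adj.counit.app P) = 𝟙 _ := by rw [← R.map_comp, hs, R.map_id]
    rw [← IsIso.inv_eq_of_inv_hom_id this]
    infer_instance
  have : IsSplitEpi (adj.counit.app (L.obj (R.obj P))) :=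
    IsSplitEpi.mk' ⟨_, adj.left_triangle_components (R.obj P)⟩
  have : Epi s := by
    have : Epi (adj.counit.app P ≫ s) := by
      rw [← adj.counit_naturality s]
      exact epi_comp (L.map (R.map s)) (adj.counit.app (L.obj (R.obj P)))
    exact epi_of_epi (adj.counit.app P) s
  have : IsSplitMono s := IsSplitMono.mk' ⟨_, hs⟩
  have : IsIso s := isIso_of_epi_of_isSplitMono s
  rw [← IsIso.inv_eq_of_hom_inv_id hs]
  infer_instance

include adj in
theorem epi_counit_of_epi {X Y : A} (g : X ⟶ Y) [Epi g] [Epi (adj.counit.app X)] :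
    Epi (adj.counit.app Y) := by
  have : Epi (L.map (R.map g) ≫ adj.counit.app Y) := by
    rw [adj.counit_naturality g]
    infer_instance
  exact epi_of_epi (L.map (R.map g)) _

/-- Serves the compatibility of `Φ` with the augmentations: `f` cancels and naturality of the counit
remains. -/
theorem inv_counit_comp_map_comp_counit {P M : A} {Y Z : B} (ε : P ⟶ M)
    [IsIso (adj.counit.app P)] (φ : R.obj P ⟶ Y) (q : Y ⟶ Z) (f : R.obj M ≅ Z)
    (h : φ ≫ q = R.map ε ≫ f.hom) :
    (inv (adj.counit.app P) ≫ L.map φ) ≫ L.map q ≫ L.map f.inv ≫ adj.counit.app M = ε := by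
  rw [Category.assoc, ← L.map_comp_assoc, h, ← L.map_comp_assoc, Category.assoc, f.hom_inv_id,
    Category.comp_id]
  exact (IsIso.inv_comp_eq _).2 (adj.counit_naturality ε)

include adj in
theorem IsProjectiveCover.map_right_adjoint [L.Full] [L.Faithful] [R.PreservesEpimorphisms]
    {P K : A} {p : P ⟶ K} (hp : IsProjectiveCover p) [Epi (adj.counit.app P)] :
    IsProjectiveCover (R.map p) := by
  have := hp.projective
  have := hp.superfluous.epi
  have : IsIso (adj.counit.app P) := isIso_counit_of_projective adj
  have : Epi (adj.counit.app K) := epi_counit_of_epi adj p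
  have : L.PreservesEpimorphisms := Functor.preservesEpimorphisms_of_adjunction adj
  refine ⟨adj.projective_of_map_projective _
    (Projective.of_iso (asIso (adj.counit.app P)).symm hp.projective), inferInstance,
    fun g => ⟨fun _ => inferInstance, fun hg => ?_⟩⟩
  -- Superfluity of `p` is applied to the adjoint transpose of `g`; transposing back recovers `g`.
  have h : Epi ((L.map g ≫ adj.counit.app P) ≫ p) := by
    rw [Category.assoc, ← adj.counit_naturality p, ← Category.assoc, ← L.map_comp]
    infer_instance
  have h' : Epi (L.map g ≫ adj.counit.app P) := (hp.superfluous.epi_iff _).2 h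
  have h'' : Epi (adj.unit.app _ ≫ R.map (L.map g ≫ adj.counit.app P)) := inferInstance
  simpa using h''

variable [Abelian A] [Abelian B]

include adj in
theorem IsMinimalComplex.map_right_adjoint [L.Full] [L.Faithful] [R.PreservesEpimorphisms]
    [R.Additive] [PreservesFiniteLimits R]
    {X : ChainComplex A ℕ} {M : A} {ε : X.X 0 ⟶ M} (hX : IsMinimalComplex X ε)
    (hgen : ∀ n, Epi (adj.counit.app (X.X n))) :
    IsMinimalComplex ((R.mapHomologicalComplex _).obj X) (M := R.obj M) (R.map ε) where
  w := by
    change R.map (X.d 1 0) ≫ R.map ε = 0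
    rw [← R.map_comp, hX.w, R.map_zero]
  zero := hX.zero.map_right_adjoint adj
  one := by
    have := ((hX.one).map_right_adjoint adj).comp_isIso (kernelComparison ε R)
    rwa [map_lift_kernelComparison] at this
  succ n := by
    have := ((hX.succ n).map_right_adjoint adj).comp_isIso (kernelComparison (X.d (n + 1) n) R)
    rwa [map_lift_kernelComparison] at this

/-- If the terms of a complex of projectives are generated by a coreflective subcategory, then the
counit identifies the complex with the image of its coreflection. -/
noncomputable def counitComplexIso [L.Full] [L.Faithful] [L.Additive] [R.Additive]
    {X : ChainComplex A ℕ} (hproj : ∀ n, Projective (X.X n))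
    (hgen : ∀ n, Epi (adj.counit.app (X.X n))) :
    (L.mapHomologicalComplex _).obj ((R.mapHomologicalComplex _).obj X) ≅ X :=
  HomologicalComplex.Hom.isoOfComponents
    (fun n => @asIso _ _ _ _ (adj.counit.app (X.X n)) (isIso_counit_of_projective adj))
    (fun i j _ => (adj.counit_naturality (X.d i j)).symm)

end Coreflection

/-! ### Supports -/

section Supports

variable {k : Type u} [CommRing k] {C : Type u} [SmallCategory C]

/-- The module `X` vanishes at the objects whose classes are not in `U`. -/
def VanishesOff (X : CatMod k C) (U : Set (IsoClasses C)) : Prop :=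
  ∀ c : C, cl c ∉ U → ∀ x : X.obj c, x = 0

theorem vanishesOff_of_supp_subset {X : CatMod k C} {U : Set (IsoClasses C)} (h : supp X ⊆ U) :
    VanishesOff X U := fun c hc x => by
  by_contra hx
  exact hc (h ⟨c, rfl, nontrivial_of_ne x 0 hx⟩)

theorem VanishesOff.of_mono {X Y : CatMod k C} {U : Set (IsoClasses C)} (hY : VanishesOff Y U)
    (g : X ⟶ Y) [Mono g] : VanishesOff X U := fun c hc _ =>
  (ModuleCat.mono_iff_injective (g.app c)).1 inferInstance
    ((hY c hc _).trans (map_zero (g.app c).hom).symm)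

/-- The submodule of `X` that agrees with `X` on an upper set of isomorphism classes and vanishes
elsewhere. -/
def restrictUpper (X : CatMod k C) (U : UpperSet (IsoClasses C)) : CatMod k C where
  obj c := ModuleCat.of k
    ({ carrier := {x | cl c ∉ U → x = 0}
       zero_mem' := fun _ => rfl
       add_mem' := fun hx hy hc => by rw [hx hc, hy hc, add_zero]
       smul_mem' := fun r x hx hc => by rw [hx hc, smul_zero] } : Submodule k (X.obj c))
  map {c d} u := ModuleCat.ofHom ((X.map u).hom.restrict fun x hx hd => by
    rw [hx fun hc => hd (U.upper (cl_le_cl_iff.2 ⟨u⟩) hc), map_zero])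
  map_id c :=
    ModuleCat.hom_ext <| LinearMap.ext fun x => by
      apply Subtype.ext
      exact ConcreteCategory.congr_hom (X.map_id c) x.1
  map_comp u v :=
    ModuleCat.hom_ext <| LinearMap.ext fun x => by
      apply Subtype.ext
      exact ConcreteCategory.congr_hom (X.map_comp u v) x.1

/-- The inclusion of `restrictUpper X U` into `X`. -/
def restrictUpperι (X : CatMod k C) (U : UpperSet (IsoClasses C)) : restrictUpper X U ⟶ X where
  app _ := ModuleCat.ofHom (Submodule.subtype _)
  naturality _ _ _ := rfl

/-- The source of a projective cover vanishes where the upper closure of the support of its target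
does. -/
theorem VanishesOff.of_isProjectiveCover {P K : CatMod k C} {U : UpperSet (IsoClasses C)}
    (hK : VanishesOff K U) {p : P ⟶ K} (hp : IsProjectiveCover p) : VanishesOff P U := by
  have hp' := hp.superfluous.epi
  -- The part of `P` on `U` already surjects onto `K`, which is zero elsewhere, so superfluity makes
  -- it all of `P`.
  have h : Epi (restrictUpperι P U ≫ p) := by
    refine (NatTrans.epi_iff_epi_app _).2 fun c => (ModuleCat.epi_iff_surjective _).2 fun y => ?_
    by_cases hc : cl c ∈ U
    · obtain ⟨x, hx⟩ := (ModuleCat.epi_iff_surjective (p.app c)).1 inferInstance y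
      exact ⟨⟨x, fun h => absurd hc h⟩, hx⟩
    · exact ⟨0, by rw [map_zero, hK c hc y]⟩
  have h' : Epi (restrictUpperι P U) := (hp.superfluous.epi_iff _).2 h
  intro c hc x
  obtain ⟨y, rfl⟩ := (ModuleCat.epi_iff_surjective ((restrictUpperι P U).app c)).1 inferInstance x
  exact y.2 hc

theorem IsMinimalComplex.vanishesOff {X : ChainComplex (CatMod k C) ℕ} {M : CatMod k C}
    {ε : X.X 0 ⟶ M} (hX : IsMinimalComplex X ε) {U : UpperSet (IsoClasses C)}
    (hM : VanishesOff M U) : ∀ n, VanishesOff (X.X n) U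
  | 0 => hM.of_isProjectiveCover hX.zero
  | 1 => (VanishesOff.of_mono (hX.vanishesOff hM 0) (kernel.ι ε)).of_isProjectiveCover hX.one
  | n + 2 => (VanishesOff.of_mono (hX.vanishesOff hM (n + 1))
      (kernel.ι (X.d (n + 1) n))).of_isProjectiveCover (hX.succ n)

end Supports

/-! ### Generation by the values along a functor -/

section Generation

variable {k : Type u} [CommRing k] {C E : Type u} [SmallCategory C] [SmallCategory E]

/-- The module `X` is generated by its values at the objects in the image of `F`. -/
def IsGeneratedAlong (F : E ⥤ C) (X : CatMod k C) : Prop :=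
  ∀ c : C, ⨆ (a : E) (v : F.obj a ⟶ c), LinearMap.range (X.map v).hom = ⊤

theorem isIso_of_cl_eq [IsEICategory C] {b c : C} (u : b ⟶ c) (h : cl b = cl c) : IsIso u := by
  obtain ⟨i⟩ := cl_eq_iff.1 h
  have : IsIso (i.inv ≫ u) := IsEICategory.isIso_of_endo _
  exact IsIso.of_isIso_comp_left i.inv u

theorem cl_lt_cl [IsEICategory C] {b c : C} (u : b ⟶ c) (h : ¬ IsIso u) : cl b < cl c :=
  lt_of_le_of_ne (cl_le_cl_iff.2 ⟨u⟩) fun hbc => h (isIso_of_cl_eq u hbc)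

/-- A form of Nakayama's lemma: a module with Artinian support is generated by its values at the
objects in its minimal support. -/
theorem isGeneratedAlong_of_minsupp [IsEICategory C] (F : E ⥤ C) {X : CatMod k C}
    {U : Set (IsoClasses C)} (hU : U.IsWF) (hX : VanishesOff X U)
    (hF : ∀ c : C, cl c ∈ minsupp X → ∃ a : E, Nonempty (F.obj a ≅ c)) :
    IsGeneratedAlong F X := by
  have key : ∀ x ∈ U, ∀ c : C, cl c = x →
      ⨆ (a : E) (v : F.obj a ⟶ c), LinearMap.range (X.map v).hom = ⊤ := by
    intro x hx
    refine Set.WellFoundedOn.induction hU hx (P := fun x => ∀ c : C, cl c = x →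
      ⨆ (a : E) (v : F.obj a ⟶ c), LinearMap.range (X.map v).hom = ⊤) fun x _ ih c hc => ?_
    subst hc
    by_cases hm : cl c ∈ minsupp X
    · obtain ⟨a, ⟨i⟩⟩ := hF c hm
      refine top_le_iff.1 (le_trans (top_le_iff.2 ?_) (le_iSup₂ a i.hom))
      exact LinearMap.range_eq_top.2 ((ModuleCat.epi_iff_surjective (X.map i.hom)).1 inferInstance)
    -- Off the minimal support, `X(c)` is spanned by images of non-isomorphisms, whose sources are
    -- strictly smaller by EI: either the induction hypothesis applies, or the source lies outside
    -- `U` and contributes nothing.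
    · have hj : jrad X c = ⊤ := by
        by_contra h
        exact hm ⟨c, rfl, Submodule.Quotient.nontrivial_iff.2 h⟩
      rw [← top_le_iff, ← hj]
      refine iSup_le fun b => iSup₂_le fun u hu => ?_
      by_cases hb : cl b ∈ U
      · rw [LinearMap.range_eq_map, ← ih _ hb (cl_lt_cl u hu) b rfl, Submodule.map_iSup]
        refine iSup_le fun a => ?_
        rw [Submodule.map_iSup]
        refine iSup_le fun v => ?_
        refine le_iSup₂_of_le a (v ≫ u) ?_
        rw [X.map_comp, ModuleCat.hom_comp, LinearMap.range_comp]
      · rintro _ ⟨y, rfl⟩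
        rw [hX b hb y, map_zero]
        exact zero_mem _
  intro c
  by_cases hc : cl c ∈ U
  · exact key _ hc c rfl
  · refine top_le_iff.1 fun x _ => ?_
    rw [hX c hc x]
    exact zero_mem _

/-- A morphism killed by the counit restricts to zero by adjunction, so it kills the generating
values. -/
theorem IsGeneratedAlong.epi_counit {F : E ⥤ C} {X : CatMod k C} (h : IsGeneratedAlong F X) :
    Epi ((indResAdj k F).counit.app X) := by
  refine Preadditive.epi_of_cancel_zero _ fun {Z} g hg => ?_
  have hr : (res k F).map g = 0 := by
    apply ((indResAdj k F).homEquiv _ _).symm.injective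
    rw [Adjunction.homEquiv_counit, Adjunction.homEquiv_counit, Functor.map_zero, zero_comp]
    exact ((indResAdj k F).counit_naturality g).trans hg
  ext c : 2
  refine ModuleCat.hom_ext (LinearMap.ker_eq_top.1 (top_le_iff.1 ?_))
  rw [← h c]
  refine iSup₂_le fun a v => ?_
  rintro _ ⟨y, rfl⟩
  have h₁ : g.app (F.obj a) = 0 := congr_app hr a
  have h₂ := congr($(g.naturality v) y)
  rw [h₁, zero_comp] at h₂
  exact h₂

/-- An inverse of `v ≫ u` would give a morphism `c ⟶ b`, and then EI would make `u` invertible. -/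
theorem not_isIso_comp_of_not_isIso [IsEICategory C] {a b c : C} (v : a ⟶ b) (u : b ⟶ c)
    (hu : ¬ IsIso u) : ¬ IsIso (v ≫ u) := fun _ =>
  hu (isIso_of_cl_eq u (le_antisymm (cl_le_cl_iff.2 ⟨u⟩)
    (cl_le_cl_iff.2 ⟨inv (v ≫ u) ≫ v⟩)))

theorem IsGeneratedAlong.jrad_res [IsEICategory C] {F : E ⥤ C} [F.Full] [F.Faithful]
    {X : CatMod k C} (h : IsGeneratedAlong F X) (a : E) :
    jrad ((res k F).obj X) a = jrad X (F.obj a) := by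
  apply le_antisymm
  · refine iSup_le fun b => iSup₂_le fun u hu => ?_
    exact le_iSup_of_le (F.obj b) (le_iSup₂_of_le (F.map u)
      (fun _ => hu (isIso_of_fully_faithful F u)) le_rfl)
  · refine iSup_le fun b => iSup₂_le fun u hu => ?_
    -- The source `b` need not be in the image of `F`, but `X(b)` is generated from there. The
    -- composites `v ≫ u` remain non-isomorphisms and lift along the full functor `F`.
    rw [LinearMap.range_eq_map, ← h b, Submodule.map_iSup]
    refine iSup_le fun a' => ?_
    rw [Submodule.map_iSup]
    refine iSup_le fun v => ?_
    have hw : ¬ IsIso (F.preimage (v ≫ u)) := fun hw =>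
      not_isIso_comp_of_not_isIso v u hu (by rw [← F.map_preimage (v ≫ u)]; infer_instance)
    refine le_iSup_of_le a' (le_iSup₂_of_le (F.preimage (v ≫ u)) hw ?_)
    rw [← LinearMap.range_comp, ← ModuleCat.hom_comp, ← X.map_comp]
    change _ ≤ LinearMap.range (X.map (F.map (F.preimage (v ≫ u)))).hom
    rw [F.map_preimage]

theorem jrad_eq_top_of_epi {X Y : CatMod k C} (g : X ⟶ Y) [Epi g] {c : C} (h : jrad X c = ⊤) :
    jrad Y c = ⊤ := by
  have hg : Function.Surjective (g.app c).hom :=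
    (ModuleCat.epi_iff_surjective (g.app c)).1 inferInstance
  rw [← top_le_iff, ← LinearMap.range_eq_top.2 hg, LinearMap.range_eq_map, ← h, jrad]
  simp only [Submodule.map_iSup]
  refine iSup_le fun b => iSup₂_le fun u hu => le_iSup_of_le b (le_iSup₂_of_le u hu ?_)
  rw [← LinearMap.range_comp, ← ModuleCat.hom_comp, g.naturality, ModuleCat.hom_comp]
  exact LinearMap.range_comp_le_range _ _

theorem jrad_eq_top_of_iso (X : CatMod k C) {c d : C} (i : c ≅ d) (h : jrad X c = ⊤) :
    jrad X d = ⊤ := by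
  have hg : Function.Surjective (X.map i.hom).hom :=
    (ModuleCat.epi_iff_surjective (X.map i.hom)).1 inferInstance
  rw [← top_le_iff, ← LinearMap.range_eq_top.2 hg, LinearMap.range_eq_map, ← h, jrad]
  simp only [Submodule.map_iSup]
  refine iSup_le fun b => iSup₂_le fun u hu => le_iSup_of_le b (le_iSup₂_of_le (u ≫ i.hom) ?_ ?_)
  · exact fun _ => hu (IsIso.of_isIso_comp_right u i.hom)
  · rw [← LinearMap.range_comp, ← ModuleCat.hom_comp, ← X.map_comp]

theorem cl_mem_minsupp_iff {X : CatMod k C} {c : C} : cl c ∈ minsupp X ↔ jrad X c ≠ ⊤ := by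
  refine ⟨?_, fun h => ⟨c, rfl, Submodule.Quotient.nontrivial_iff.2 h⟩⟩
  rintro ⟨d, hd, hn⟩ h
  obtain ⟨i⟩ := cl_eq_iff.1 hd
  exact Submodule.Quotient.nontrivial_iff.1 hn (jrad_eq_top_of_iso X i.symm h)

theorem IsGeneratedAlong.cl_mem_minsupp_res_iff [IsEICategory C] {F : E ⥤ C} [F.Full] [F.Faithful]
    {X : CatMod k C} (h : IsGeneratedAlong F X) (a : E) :
    cl a ∈ minsupp ((res k F).obj X) ↔ cl (F.obj a) ∈ minsupp X := by
  rw [cl_mem_minsupp_iff, cl_mem_minsupp_iff]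
  exact not_congr (Eq.congr_left (h.jrad_res a))

theorem minsupp_eq_of_iso {X Y : CatMod k C} (e : X ≅ Y) : minsupp X = minsupp Y := by
  ext ⟨c⟩
  change cl c ∈ _ ↔ cl c ∈ _
  rw [cl_mem_minsupp_iff, cl_mem_minsupp_iff]
  exact not_congr ⟨jrad_eq_top_of_epi e.hom, jrad_eq_top_of_epi e.inv⟩

end Generation

/-! ### Restriction and induction of minimal resolutions -/

section Transfer

variable {k : Type u} [CommRing k] {C D E : Type u} [SmallCategory C] [SmallCategory D]
  [SmallCategory E]

/-- This is where the Artinian hypothesis enters. -/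
theorem IsMinimalResolution.isGeneratedAlong [IsEICategory C] {M : CatMod k C}
    {P : ProjectiveResolution M} (hP : IsMinimalResolution P)
    (hM : Set.IsWF (upperClosure (supp M) : Set (IsoClasses C))) {F : E ⥤ C}
    (hF : ∀ c : C, bettiObjects P c → ∃ a : E, Nonempty (F.obj a ≅ c)) (n : ℕ) :
    IsGeneratedAlong F (P.complex.X n) :=
  isGeneratedAlong_of_minsupp F hM
    (hP.isMinimalComplex.vanishesOff (vanishesOff_of_supp_subset subset_upperClosure) n)
    fun c hc => hF c (Set.mem_iUnion.2 ⟨n, hc⟩)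

variable {M : CatMod k C} {N : CatMod k D} {P : ProjectiveResolution M}
  {Q : ProjectiveResolution N} {F : E ⥤ C} {G : E ⥤ D} [F.Full] [F.Faithful] [G.Full] [G.Faithful]

/-- Left Kan extension along a fully faithful functor has an invertible unit. -/
instance ind_full : (ind k F).Full := (indResAdj k F).fullyFaithfulLOfIsIsoUnit.full

instance ind_faithful : (ind k F).Faithful := (indResAdj k F).fullyFaithfulLOfIsIsoUnit.faithful

theorem IsMinimalResolution.exists_res_iso (hP : IsMinimalResolution P)
    (hQ : IsMinimalResolution Q) (hF : ∀ n, IsGeneratedAlong F (P.complex.X n))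
    (hG : ∀ n, IsGeneratedAlong G (Q.complex.X n)) (f : (res k F).obj M ≅ (res k G).obj N) :
    ∃ φ : (resComplex k F).obj P.complex ≅ (resComplex k G).obj Q.complex,
      φ.hom.f 0 ≫ (res k G).map (augmentation Q) = (res k F).map (augmentation P) ≫ f.hom :=
  (hP.isMinimalComplex.map_right_adjoint (indResAdj k F) fun n => (hF n).epi_counit).exists_iso
    (hQ.isMinimalComplex.map_right_adjoint (indResAdj k G) fun n => (hG n).epi_counit) f

theorem IsMinimalResolution.exists_ind_res_iso (hP : IsMinimalResolution P)
    (hQ : IsMinimalResolution Q) (hF : ∀ n, IsGeneratedAlong F (P.complex.X n))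
    (hG : ∀ n, IsGeneratedAlong G (Q.complex.X n)) (f : (res k F).obj M ≅ (res k G).obj N) :
    ∃ Φ : P.complex ≅ (indComplex k F).obj ((resComplex k G).obj Q.complex),
      Φ.hom.f 0 ≫ (ind k F).map ((res k G).map (augmentation Q)) ≫
          (ind k F).map f.inv ≫ (indResAdj k F).counit.app M = augmentation P := by
  obtain ⟨φ, hφ⟩ := hP.exists_res_iso hQ hF hG f
  refine ⟨(counitComplexIso (indResAdj k F) P.projective fun n => (hF n).epi_counit).symm ≪≫
    (indComplex k F).mapIso φ, ?_⟩
  have := (hF 0).epi_counit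
  have := isIso_counit_of_projective (indResAdj k F) (P := P.complex.X 0)
  exact inv_counit_comp_map_comp_counit (indResAdj k F) (augmentation P) (φ.hom.f 0)
    ((res k G).map (augmentation Q)) f hφ

/-- In each degree both sides can be tested at `a` on the restricted terms, which are isomorphic. -/
theorem IsMinimalResolution.bettiObjects_iff [IsEICategory C] [IsEICategory D]
    (hP : IsMinimalResolution P)
    (hQ : IsMinimalResolution Q) (hF : ∀ n, IsGeneratedAlong F (P.complex.X n))
    (hG : ∀ n, IsGeneratedAlong G (Q.complex.X n)) (f : (res k F).obj M ≅ (res k G).obj N)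
    (a : E) : bettiObjects P (F.obj a) ↔ bettiObjects Q (G.obj a) := by
  obtain ⟨φ, -⟩ := hP.exists_res_iso hQ hF hG f
  simp only [bettiObjects, minsuppComplex, Set.mem_iUnion]
  refine exists_congr fun n => ?_
  rw [← (hF n).cl_mem_minsupp_res_iff, ← (hG n).cl_mem_minsupp_res_iff]
  exact Eq.to_iff (congrArg (cl a ∈ ·)
    (minsupp_eq_of_iso ((HomologicalComplex.eval _ _ n).mapIso φ)))

end Transfer

/-- Two functors from a full subcategory that are equivalences onto full subcategories
`S` and `T` of their targets give an equivalence of these. -/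
theorem exists_equivalence_fullSubcategory {A C D : Type*} [Category* A] [Category* C] [Category* D]
    (S : ObjectProperty C) (T : ObjectProperty D) (I : A ⥤ S.FullSubcategory)
    (J : A ⥤ T.FullSubcategory) [I.IsEquivalence] [J.IsEquivalence] :
    ∃ e : S.FullSubcategory ≌ T.FullSubcategory, Nonempty (I ⋙ e.functor ≅ J) :=
  ⟨I.asEquivalence.symm.trans J.asEquivalence,
    ⟨(Functor.associator _ _ _).symm ≪≫
      Functor.isoWhiskerRight I.asEquivalence.unitIso.symm J ≪≫ J.leftUnitor⟩⟩

end BettiCat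

open BettiCat in
theorem mainTheorem1 {k : Type u} [CommRing k]
    {C D : Type u} [SmallCategory C] [SmallCategory D] [IsEICategory C] [IsEICategory D]
    {M : CatMod k C} {N : CatMod k D}
    (P : ProjectiveResolution M) (hP : IsMinimalResolution P)
    (Q : ProjectiveResolution N) (hQ : IsMinimalResolution Q)
    (hM : Set.IsWF (upperClosure (supp M) : Set (IsoClasses C)))
    (hN : Set.IsWF (upperClosure (supp N) : Set (IsoClasses D)))
    (C' : ObjectProperty C) (hC' : minsuppComplex P.complex ⊆ classesOf C')
    (D' : ObjectProperty D) (hD' : minsuppComplex Q.complex ⊆ classesOf D')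
    (α : C'.FullSubcategory ⥤ D'.FullSubcategory) [α.IsEquivalence]
    (f : (res k C'.ι).obj M ≅ (res k (α ⋙ D'.ι)).obj N) :
    -- `α` induces an equivalence of Betti categories: on the objects of `C'` the two
    -- Betti categories correspond under `α`, and there is an equivalence `e` of the
    -- Betti categories that agrees with `α` on the objects that lie in `C'`
    ((∀ c : C'.FullSubcategory, bettiObjects P c.obj ↔ bettiObjects Q (α.obj c).obj) ∧
      ∃ e : BettiCategory P ≌ BettiCategory Q,
        Nonempty
          (ObjectProperty.ιOfLE (inf_le_right : C' ⊓ bettiObjects P ≤ bettiObjects P) ⋙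
              e.functor ⋙ (bettiObjects Q).ι ≅
            ObjectProperty.ιOfLE (inf_le_left : C' ⊓ bettiObjects P ≤ C') ⋙
              α ⋙ D'.ι)) ∧
    -- `f` induces an isomorphism of chain complexes: there is an isomorphism that is
    -- compatible with the augmentations and with `f`
    ∃ Φ : P.complex ≅
        (indComplex k C'.ι).obj ((resComplex k (α ⋙ D'.ι)).obj Q.complex),
      Φ.hom.f 0 ≫ (ind k C'.ι).map ((res k (α ⋙ D'.ι)).map (augmentation Q)) ≫
          (ind k C'.ι).map f.inv ≫ (indResAdj k C'.ι).counit.app M =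
        augmentation P := by
  have hF : ∀ c, bettiObjects P c → ∃ a, Nonempty (C'.ι.obj a ≅ c) := fun c hc => by
    obtain ⟨a, ha, h⟩ := hC' hc
    exact ⟨⟨a, ha⟩, cl_eq_iff.1 h⟩
  have hG : ∀ d, bettiObjects Q d → ∃ a, Nonempty ((α ⋙ D'.ι).obj a ≅ d) := fun d hd => by
    obtain ⟨b, hb, h⟩ := hD' hd
    obtain ⟨i⟩ := cl_eq_iff.1 h
    exact ⟨α.objPreimage ⟨b, hb⟩, ⟨D'.ι.mapIso (α.objObjPreimageIso ⟨b, hb⟩) ≪≫ i⟩⟩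
  have hFP := hP.isGeneratedAlong hM hF
  have hGQ := hQ.isGeneratedAlong hN hG
  have hiff : ∀ c : C'.FullSubcategory, bettiObjects P c.obj ↔ bettiObjects Q (α.obj c).obj :=
    hP.bettiObjects_iff hQ hFP hGQ f
  refine ⟨⟨hiff, ?_⟩, hP.exists_ind_res_iso hQ hFP hGQ f⟩
  -- `C'` need not be closed under isomorphism, so it may miss objects of the Betti category of `M`.
  -- Both Betti categories are therefore compared with the full subcategory of common objects; `I`
  -- and `J` are fully faithful, and only essential surjectivity needs an argument.
  let I := ObjectProperty.ιOfLE (inf_le_right : C' ⊓ bettiObjects P ≤ bettiObjects P)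
  let J₀ := ObjectProperty.ιOfLE (inf_le_left : C' ⊓ bettiObjects P ≤ C') ⋙ α ⋙ D'.ι
  let J : (C' ⊓ bettiObjects P).FullSubcategory ⥤ BettiCategory Q :=
    (bettiObjects Q).lift J₀ fun c => (hiff ⟨c.obj, c.property.1⟩).1 c.property.2
  have hI : I.EssSurj := ⟨fun c => by
    obtain ⟨a, ⟨i⟩⟩ := hF c.obj c.property
    have ha : bettiObjects P a.obj := by
      have := c.property
      rwa [bettiObjects, ← cl_eq_iff.2 ⟨i⟩] at this
    exact ⟨⟨a.obj, a.property, ha⟩, ⟨(bettiObjects P).isoMk i⟩⟩⟩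
  have hJ : J.EssSurj := ⟨fun d => by
    obtain ⟨a, ⟨i⟩⟩ := hG d.obj d.property
    have ha : bettiObjects P a.obj := by
      have := d.property
      rw [bettiObjects, ← cl_eq_iff.2 ⟨i⟩] at this
      exact (hiff a).2 this
    exact ⟨⟨a.obj, a.property, ha⟩, ⟨(bettiObjects Q).isoMk i⟩⟩⟩
  have : I.IsEquivalence := {}
  have : J.IsEquivalence := {}
  obtain ⟨e, ⟨i⟩⟩ := exists_equivalence_fullSubcategory _ _ I J
  exact ⟨e, ⟨Functor.isoWhiskerRight i (bettiObjects Q).ι⟩⟩
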